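/- Let $\ell\ge 0$, let $M$ be a (Hausdorff) smooth manifold of real dimension $\ell+2$, and let $\mathcal F$ be a transversely holomorphic foliation of complex codimension one on $M$: $M$ is covered by smooth charts $(x,z)$ with values in open subsets of $\mathbb R^\ell\times\mathbb C$ in which $\mathcal F$ is given by $z=\mathrm{const}$, and on overlaps the transverse coordinate $z$ of one chart is locally a biholomorphic function of that of the other. Let $\Lambda\subset M$ be a finite union of compact leaves of $\mathcal F$ and suppose that $\mathcal F$ is holomorphically transversely additive on $M\setminus\Lambda$: there are an open cover $(U_j)$ of $M\setminus\Lambda$ and transversely holomorphic submersions $y_j\colon U_j\to\mathbb C$ defining $\mathcal F|_{U_j}$ (locally, $y_j=f(z)$ with $f$ holomorphic and $f'\neq0$) such that $y_i-y_j$ is locally constant on $U_i\cap U_j$ for all $i,j$. For a leaf $L$, a point $p\in L$ and a disc $D$ transverse to $\mathcal F$ at $p$ with a holomorphic coordinate centred at $p$, let $\mathrm{Hol}(\mathcal F,L,D,p)\subset\mathrm{Diff}(\mathbb C,0)$ be the group of holonomy germs of loops in $L$ based at $p$; up to conjugation in $\mathrm{Diff}(\mathbb C,0)$ it does not depend on $p$,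 $D$ and the coordinate. Let $L\subset\Lambda$ be a leaf whose holonomy group contains a hyperbolic attractor, i.e. a germ $f$ with $0<|f'(0)|<1$. Then the holonomy group $\mathrm{Hol}(\mathcal F,L)$ is abelian and analytically linearizable: for every $p\in L$ and every $D$ as above, $\mathrm{Hol}(\mathcal F,L,D,p)$ is abelian and there is $\varphi\in\mathrm{Diff}(\mathbb C,0)$ such that every $f\in\mathrm{Hol}(\mathcal F,L,D,p)$ satisfies $\varphi\circ f\circ\varphi^{-1}(z)=a_f z$ for some $a_f\in\mathbb C\setminus\{0\}$. -/

import Mathlib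

open Set Filter Topology Manifold
open scoped ContDiff

/-! ## The group of germs of biholomorphisms of `(ℂ, 0)` -/

/-- A representative of a germ at `0` of a biholomorphism of `ℂ` fixing `0`: a function that is
holomorphic near `0`, fixes `0` and has non-zero derivative there. Its values away from `0` are
irrelevant. -/
structure LocalBihol where
  toFun : ℂ → ℂ
  analyticAt : AnalyticAt ℂ toFun 0
  map_zero : toFun 0 = 0
  deriv_ne_zero : deriv toFun 0 ≠ 0

namespace LocalBihol

/-- Two representatives define the same germ if they agree near `0`. -/
instance setoid : Setoid LocalBihol where
  r f g := f.toFun =ᶠ[𝓝 0] g.toFun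
  iseqv := ⟨fun _ => EventuallyEq.rfl, fun h => h.symm, fun h k => h.trans k⟩

theorem tendsto (f : LocalBihol) : Tendsto f.toFun (𝓝 0) (𝓝 0) := by
  have h := f.analyticAt.continuousAt.tendsto
  rwa [f.map_zero] at h

/-- Composition of representatives. -/
def comp (f g : LocalBihol) : LocalBihol where
  toFun := f.toFun ∘ g.toFun
  analyticAt := AnalyticAt.comp (by rw [g.map_zero]; exact f.analyticAt) g.analyticAt
  map_zero := by simp [g.map_zero, f.map_zero]
  deriv_ne_zero := by
    rw [deriv_comp (0 : ℂ) (by rw [g.map_zero]; exact f.analyticAt.differentiableAt)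
      g.analyticAt.differentiableAt, g.map_zero]
    exact mul_ne_zero f.deriv_ne_zero g.deriv_ne_zero

/-- Multiplication by a non-zero constant. -/
def linear (a : ℂˣ) : LocalBihol where
  toFun z := (a : ℂ) * z
  analyticAt := analyticAt_const.mul analyticAt_id
  map_zero := by simp
  deriv_ne_zero := by simp

theorem exists_inverse (f : LocalBihol) :
    ∃ k : LocalBihol, (∀ᶠ z in 𝓝 0, k.toFun (f.toFun z) = z) ∧
      ∀ᶠ z in 𝓝 0, f.toFun (k.toFun z) = z := by
  have hs := f.analyticAt.hasStrictDerivAt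
  have h1 := hs.eventually_left_inverse f.deriv_ne_zero
  have h2 := hs.eventually_right_inverse f.deriv_ne_zero
  have h3 := f.analyticAt.analyticAt_localInverse f.deriv_ne_zero
  have h4 := (hs.to_localInverse f.deriv_ne_zero).hasDerivAt.deriv
  have h5 := h1.self_of_nhds
  rw [f.map_zero] at h2 h3 h4 h5
  exact ⟨⟨_, h3, h5, by rw [h4]; exact inv_ne_zero f.deriv_ne_zero⟩, h1, h2⟩

/-- A local inverse. -/
noncomputable def inverse (f : LocalBihol) : LocalBihol := f.exists_inverse.choose

theorem inverse_left (f : LocalBihol) : ∀ᶠ z in 𝓝 0, f.inverse.toFun (f.toFun z) = z :=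
  f.exists_inverse.choose_spec.1

theorem inverse_right (f : LocalBihol) : ∀ᶠ z in 𝓝 0, f.toFun (f.inverse.toFun z) = z :=
  f.exists_inverse.choose_spec.2

end LocalBihol

/-- `Diff(ℂ, 0)`: germs at `0` of biholomorphisms fixing `0`. -/
def DiffGerm : Type := Quotient LocalBihol.setoid

namespace DiffGerm

/-- The germ of a representative. -/
def mk (f : LocalBihol) : DiffGerm := Quotient.mk _ f

theorem mk_eq_mk {f g : LocalBihol} : mk f = mk g ↔ f.toFun =ᶠ[𝓝 0] g.toFun :=
  Quotient.eq (r := LocalBihol.setoid)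

/-- `Diff(ℂ, 0)` is a group under composition. -/
noncomputable instance group : Group DiffGerm where
  mul := Quotient.map₂ LocalBihol.comp (by
    intro f f' hf g g' hg
    have h1 : f.toFun ∘ g.toFun =ᶠ[𝓝 0] f'.toFun ∘ g.toFun := hf.comp_tendsto g.tendsto
    exact h1.trans (hg.fun_comp f'.toFun))
  one := mk (LocalBihol.linear 1)
  inv := Quotient.map LocalBihol.inverse (by
    intro f g (hfg : f.toFun =ᶠ[𝓝 0] g.toFun)
    change f.inverse.toFun =ᶠ[𝓝 0] g.inverse.toFun
    filter_upwards [g.inverse_right, g.inverse.tendsto.eventually hfg,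
      g.inverse.tendsto.eventually f.inverse_left] with z h1 h2 h3
    rw [← h3, h2, h1])
  mul_assoc a b c := by
    induction a using Quotient.inductionOn
    induction b using Quotient.inductionOn
    induction c using Quotient.inductionOn
    rfl
  one_mul a := by
    induction a using Quotient.inductionOn with
    | h f => exact mk_eq_mk.2 (Eventually.of_forall fun z => by
        simp [LocalBihol.comp, LocalBihol.linear])
  mul_one a := by
    induction a using Quotient.inductionOn with
    | h f => exact mk_eq_mk.2 (Eventually.of_forall fun z => by
        simp [LocalBihol.comp, LocalBihol.linear])
  inv_mul_cancel a := by
    induction a using Quotient.inductionOn with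
    | h f => exact mk_eq_mk.2 (f.inverse_left.mono fun z hz => by
        simpa [LocalBihol.comp, LocalBihol.linear] using hz)

theorem mk_mul_mk (f g : LocalBihol) : mk f * mk g = mk (f.comp g) := rfl

theorem one_def : (1 : DiffGerm) = mk (LocalBihol.linear 1) := rfl

theorem inv_mk (f : LocalBihol) : (mk f)⁻¹ = mk f.inverse := rfl

/-- The derivative at `0` of a germ. -/
noncomputable def multiplier : DiffGerm → ℂ :=
  Quotient.lift (fun f : LocalBihol => deriv f.toFun 0) fun _ _ h => h.deriv_eq

/-- The linear germ `z ↦ a z`. -/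
def linear (a : ℂˣ) : DiffGerm := mk (LocalBihol.linear a)

/-- A hyperbolic attractor: a germ `f` with `|f'(0)| < 1` (and `f'(0) ≠ 0`, as for all germs in
`Diff(ℂ, 0)`). -/
def IsHyperbolicAttractor (f : DiffGerm) : Prop := ‖f.multiplier‖ < 1

/-- A subgroup of `Diff(ℂ, 0)` is (analytically) linearizable if one holomorphic change of
coordinate conjugates all its elements simultaneously to linear germs. -/
def IsLinearizable (G : Subgroup DiffGerm) : Prop :=
  ∃ φ : DiffGerm, ∀ f ∈ G, ∃ a : ℂˣ, φ * f * φ⁻¹ = linear a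

end DiffGerm

/-! ## Transversely holomorphic foliations of complex codimension one -/

/-- A transversely holomorphic foliation of complex codimension one on a smooth manifold `M` of
real dimension `ℓ + 2`: an atlas of smooth charts `(x, z)` with values in open subsets of
`ℝ^ℓ × ℂ` (the foliation being locally given by `z = const`), such that on overlaps the coordinate
`z` of one chart is locally a biholomorphic function of the coordinate `z` of the other. -/
structure TransvHolFoliation (ℓ : ℕ) (M : Type*) [TopologicalSpace M]
    [ChartedSpace (EuclideanSpace ℝ (Fin (ℓ + 2))) M] where
  atlas : Set (OpenPartialHomeomorph M (EuclideanSpace ℝ (Fin ℓ) × ℂ))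
  cover : ∀ p : M, ∃ e ∈ atlas, p ∈ e.source
  smooth : ∀ e ∈ atlas,
    ContMDiffOn (𝓡 (ℓ + 2)) 𝓘(ℝ, EuclideanSpace ℝ (Fin ℓ) × ℂ) ∞ e e.source
  smooth_symm : ∀ e ∈ atlas,
    ContMDiffOn 𝓘(ℝ, EuclideanSpace ℝ (Fin ℓ) × ℂ) (𝓡 (ℓ + 2)) ∞ e.symm e.target
  transition : ∀ e ∈ atlas, ∀ e' ∈ atlas, ∀ p ∈ e.source ∩ e'.source,
    ∃ γ : ℂ → ℂ, AnalyticAt ℂ γ (e p).2 ∧ deriv γ (e p).2 ≠ 0 ∧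
      ∀ᶠ q in 𝓝 p, (e' q).2 = γ (e q).2

namespace TransvHolFoliation

section

variable {ℓ : ℕ} {M : Type*} [TopologicalSpace M]
  [ChartedSpace (EuclideanSpace ℝ (Fin (ℓ + 2))) M] (F : TransvHolFoliation ℓ M)

/-- The leaf topology on `M`: it is generated by the open subsets of the slices `z = c` in the
foliated charts. -/
abbrev leafTopology : TopologicalSpace M :=
  TopologicalSpace.generateFrom
    {S | ∃ e ∈ F.atlas, ∃ V : Set M, IsOpen V ∧ ∃ c : ℂ, S = V ∩ e.source ∩ {q | (e q).2 = c}}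

/-- The leaf through `p`: the connected component of `p` in the leaf topology. -/
def leaf (p : M) : Set M := @connectedComponent M F.leafTopology p

/-- `L` is a leaf of the foliation. -/
def IsLeaf (L : Set M) : Prop := ∃ p, L = F.leaf p

/-- `L` is a compact leaf, i.e. a leaf which is a compact manifold (for the leaf topology). -/
def IsCompactLeaf (L : Set M) : Prop := F.IsLeaf L ∧ @IsCompact M F.leafTopology L

/-- The path `c`, restricted to `[0, 1]`, is a path inside a leaf. -/
def IsLeafwisePath (c : ℝ → M) : Prop := @ContinuousOn ℝ M _ F.leafTopology c (Icc 0 1)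

/-- A germ of transverse holomorphic disc at `p`, with a holomorphic parameter `w`: a smooth map
`τ` from a neighbourhood of `0 ∈ ℂ` to `M` such that `τ 0 = p` and such that the transverse
coordinate `z` of the foliation is a local holomorphic coordinate along `τ`. -/
structure Transversal (p : M) where
  toFun : ℂ → M
  map_zero : toFun 0 = p
  smooth : ∀ᶠ w in 𝓝 (0 : ℂ), ContMDiffAt 𝓘(ℝ, ℂ) (𝓡 (ℓ + 2)) ∞ toFun w
  holomorphic : ∀ e ∈ F.atlas, p ∈ e.source →
    AnalyticAt ℂ (fun w => (e (toFun w)).2) 0 ∧ deriv (fun w => (e (toFun w)).2) 0 ≠ 0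

/-- `g` is the holonomy of the leafwise loop `γ` at `p`, computed on the transversal `τ`: the loop
`γ` can be continuously deformed to leafwise paths `H(·, w)` in the nearby leaves, going from
`τ w` to `τ (h w)`, where `h` represents `g`. -/
def IsHolonomyOf {p : M} (τ : F.Transversal p) (γ : ℝ → M) (g : DiffGerm) : Prop :=
  ∃ h : LocalBihol, DiffGerm.mk h = g ∧ ∃ U : Set ℂ, IsOpen U ∧ (0 : ℂ) ∈ U ∧
    ∃ H : ℝ × ℂ → M, ContinuousOn H (Icc 0 1 ×ˢ U) ∧
      (∀ t ∈ Icc (0 : ℝ) 1, H (t, 0) = γ t) ∧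
      ∀ w ∈ U, F.IsLeafwisePath (fun t => H (t, w)) ∧ H (0, w) = τ.toFun w ∧
        H (1, w) = τ.toFun (h.toFun w)

/-- Concatenation of two families of paths, the second one being reparametrized by `h`. -/
noncomputable def concat (H₁ H₂ : ℝ × ℂ → M) (h : ℂ → ℂ) : ℝ × ℂ → M :=
  fun x => if x.1 ≤ 1 / 2 then H₁ (2 * x.1, x.2) else H₂ (2 * x.1 - 1, h x.2)

theorem continuousOn_concat {X : Type*} [TopologicalSpace X] {H₁ H₂ : ℝ × ℂ → X} {h : ℂ → ℂ}
    {U V W : Set ℂ} (h1 : ContinuousOn H₁ (Icc 0 1 ×ˢ U)) (h2 : ContinuousOn H₂ (Icc 0 1 ×ˢ V))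
    (hh : ContinuousOn h W) (hWU : W ⊆ U) (hWV : MapsTo h W V)
    (heq : ∀ w ∈ W, H₁ (1, w) = H₂ (0, h w)) :
    ContinuousOn (concat H₁ H₂ h) (Icc 0 1 ×ˢ W) := by
  have hfr : frontier {x : ℝ × ℂ | x.1 ≤ 1 / 2} ⊆ {x | x.1 = 1 / 2} :=
    frontier_le_subset_eq continuous_fst continuous_const
  have hcl : closure {x : ℝ × ℂ | x.1 ≤ 1 / 2} = {x | x.1 ≤ 1 / 2} :=
    (isClosed_le continuous_fst continuous_const).closure_eq
  have hcl' : closure {x : ℝ × ℂ | ¬ x.1 ≤ 1 / 2} ⊆ {x | 1 / 2 ≤ x.1} := by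
    refine closure_minimal (fun x hx => ?_) (isClosed_le continuous_const continuous_fst)
    simp only [mem_ofPred_eq, not_le] at hx ⊢
    exact hx.le
  refine ContinuousOn.if ?_ ?_ ?_
  · rintro ⟨t, w⟩ ⟨⟨_, hw⟩, ht⟩
    have ht' : t = 1 / 2 := hfr ht
    subst ht'
    have := heq w hw
    norm_num
    exact this
  · rw [hcl]
    refine h1.comp (by fun_prop) ?_
    rintro ⟨t, w⟩ ⟨⟨⟨ht0, _⟩, hw⟩, ht⟩
    simp only [mem_ofPred_eq] at ht ht0
    exact ⟨⟨by simpa using ht0, by simp only; linarith⟩, hWU hw⟩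
  · refine h2.comp ?_ ?_
    · refine ContinuousOn.prodMk (by fun_prop) ?_
      exact hh.comp continuousOn_snd fun x hx => hx.1.2
    · rintro ⟨t, w⟩ ⟨⟨⟨_, ht1⟩, hw⟩, ht⟩
      have ht2 : 1 / 2 ≤ t := hcl' ht
      simp only at ht1
      exact ⟨⟨by simp only; linarith, by simp only; linarith⟩, hWV hw⟩

theorem continuousOn_concat_slice {X : Type*} [TopologicalSpace X] {H₁ H₂ : ℝ × ℂ → X} {h : ℂ → ℂ}
    {w : ℂ} (h1 : ContinuousOn (fun t => H₁ (t, w)) (Icc 0 1))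
    (h2 : ContinuousOn (fun t => H₂ (t, h w)) (Icc 0 1)) (heq : H₁ (1, w) = H₂ (0, h w)) :
    ContinuousOn (fun t => concat H₁ H₂ h (t, w)) (Icc 0 1) := by
  have a := continuousOn_concat (H₁ := fun x => H₁ (x.1, w)) (H₂ := fun x => H₂ (x.1, h w))
    (h := h) (U := univ) (V := univ) (W := {w})
    (h1.comp continuousOn_fst fun x hx => hx.1) (h2.comp continuousOn_fst fun x hx => hx.1)
    (continuousOn_singleton _ _) (subset_univ _) (mapsTo_univ _ _) (fun _ _ => heq)
  exact a.comp (f := fun t : ℝ => (t, w)) (by fun_prop) (fun t ht => ⟨ht, rfl⟩)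

theorem continuousOn_reverse {X : Type*} [TopologicalSpace X] {c : ℝ → X}
    (hc : ContinuousOn c (Icc 0 1)) : ContinuousOn (fun t => c (1 - t)) (Icc 0 1) :=
  hc.comp (by fun_prop) fun t ht => ⟨by linarith [ht.2], by linarith [ht.1]⟩

theorem isLeafwisePath_const (q : M) : F.IsLeafwisePath fun _ => q :=
  @continuousOn_const ℝ M _ F.leafTopology _ _

/-- The holonomy group `Hol(F, L, τ, p)` of the leaf `L` through `p`, computed on the transversal
`τ` at `p`: the set of holonomy germs of all leafwise loops at `p`, i.e. the image in `Diff(ℂ, 0)`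
of the holonomy representation of the fundamental group of `L`. -/
def holonomyGroup {p : M} (τ : F.Transversal p) : Subgroup DiffGerm where
  carrier := {g | ∃ γ : ℝ → M, F.IsLeafwisePath γ ∧ γ 0 = p ∧ γ 1 = p ∧ F.IsHolonomyOf τ γ g}
  one_mem' := by
    obtain ⟨U, hU, hUo, hU0⟩ := mem_nhds_iff.1 τ.smooth
    refine ⟨fun _ => p, F.isLeafwisePath_const p, rfl, rfl, LocalBihol.linear 1, rfl, U, hUo, hU0,
      fun x => τ.toFun x.2, ?_, fun _ _ => τ.map_zero,
      fun w _ => ⟨F.isLeafwisePath_const (τ.toFun w), rfl, by simp [LocalBihol.linear]⟩⟩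
    rintro ⟨t, w⟩ ⟨-, hw⟩
    have hw' : ContMDiffAt 𝓘(ℝ, ℂ) (𝓡 (ℓ + 2)) ∞ τ.toFun w := hU hw
    exact (ContinuousAt.comp (g := τ.toFun) (f := fun x : ℝ × ℂ => x.2) (x := (t, w))
      hw'.continuousAt continuousAt_snd).continuousWithinAt
  mul_mem' := by
    rintro _ _ ⟨_, -, -, -, f, rfl, U, hU, hU0, H, hH, -, hHl⟩
      ⟨_, -, -, -, g, rfl, V, hV, hV0, K, hK, -, hKl⟩
    obtain ⟨W, hW, hWo, hW0⟩ := mem_nhds_iff.1 (((g.analyticAt.eventually_analyticAt).and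
      ((hV.eventually_mem hV0).and (g.tendsto.eventually (hU.eventually_mem hU0)))))
    have hgW : ContinuousOn g.toFun W := fun w hw => (hW hw).1.continuousAt.continuousWithinAt
    have hWV : W ⊆ V := fun w hw => (hW hw).2.1
    have hWU : MapsTo g.toFun W U := fun w hw => (hW hw).2.2
    have heq : ∀ w ∈ W, K (1, w) = H (0, g.toFun w) := fun w hw => by
      rw [(hKl w (hWV hw)).2.2, (hHl _ (hWU hw)).2.1]
    have key : ∀ w ∈ W, F.IsLeafwisePath (fun t => concat K H g.toFun (t, w)) :=
      fun w hw => @continuousOn_concat_slice M F.leafTopology K H g.toFun w (hKl w (hWV hw)).1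
        (hHl _ (hWU hw)).1 (heq w hw)
    have e0 : ∀ w ∈ W, concat K H g.toFun (0, w) = τ.toFun w := fun w hw => by
      simp [concat, (hKl w (hWV hw)).2.1]
    have e1 : ∀ w ∈ W, concat K H g.toFun (1, w) = τ.toFun (f.toFun (g.toFun w)) :=
      fun w hw => by
        rw [← (hHl _ (hWU hw)).2.2]
        norm_num [concat]
    refine ⟨fun t => concat K H g.toFun (t, 0), key 0 hW0, ?_, ?_, f.comp g, rfl, W, hWo, hW0,
      concat K H g.toFun, continuousOn_concat hK hH hgW hWV hWU heq, fun _ _ => rfl,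
      fun w hw => ⟨key w hw, e0 w hw, e1 w hw⟩⟩
    · simp only [e0 0 hW0, τ.map_zero]
    · simp only [e1 0 hW0, g.map_zero, f.map_zero, τ.map_zero]
  inv_mem' := by
    rintro _ ⟨_, -, -, -, f, rfl, U, hU, hU0, H, hH, -, hHl⟩
    obtain ⟨W, hW, hWo, hW0⟩ := mem_nhds_iff.1 (((f.inverse.analyticAt.eventually_analyticAt).and
      (f.inverse_right.and (f.inverse.tendsto.eventually (hU.eventually_mem hU0)))))
    have hgW : ContinuousOn f.inverse.toFun W :=
      fun w hw => (hW hw).1.continuousAt.continuousWithinAt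
    have hWU : MapsTo f.inverse.toFun W U := fun w hw => (hW hw).2.2
    have key : ∀ w ∈ W, F.IsLeafwisePath (fun t => H (1 - t, f.inverse.toFun w)) := fun w hw =>
      @continuousOn_reverse M F.leafTopology (fun t => H (t, f.inverse.toFun w)) (hHl _ (hWU hw)).1
    have e0 : ∀ w ∈ W, H (1 - 0, f.inverse.toFun w) = τ.toFun w := fun w hw => by
      rw [sub_zero, (hHl _ (hWU hw)).2.2]
      exact congrArg _ (hW hw).2.1
    have e1 : ∀ w ∈ W, H (1 - 1, f.inverse.toFun w) = τ.toFun (f.inverse.toFun w) :=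
      fun w hw => by rw [sub_self, (hHl _ (hWU hw)).2.1]
    refine ⟨fun t => H (1 - t, f.inverse.toFun 0), key 0 hW0, ?_, ?_, f.inverse, rfl, W, hWo, hW0,
      fun x => H (1 - x.1, f.inverse.toFun x.2), ?_, fun _ _ => rfl,
      fun w hw => ⟨key w hw, e0 w hw, e1 w hw⟩⟩
    · exact (e0 0 hW0).trans τ.map_zero
    · refine (e1 0 hW0).trans ?_
      rw [f.inverse.map_zero, τ.map_zero]
    · refine hH.comp (ContinuousOn.prodMk (by fun_prop)
        (hgW.comp continuousOn_snd fun x hx => hx.2)) ?_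
      rintro ⟨t, w⟩ ⟨⟨ht0, ht1⟩, hw⟩
      simp only at ht0 ht1
      exact ⟨⟨by simp only; linarith, by simp only; linarith⟩, hWU hw⟩

/-- The leaf `L` contains a hyperbolic attractor in its holonomy group. Up to conjugation in
`Diff(ℂ, 0)` the group does not depend on the base point and the transversal, so one choice of them
is enough. -/
def HasHyperbolicAttractor (L : Set M) : Prop :=
  ∃ p ∈ L, ∃ τ : F.Transversal p, ∃ g ∈ F.holonomyGroup τ, g.IsHyperbolicAttractor

/-- Near `q`, the function `y` is a transversely holomorphic submersion defining the foliation: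
it is locally a biholomorphic function of the transverse coordinate `z`. -/
def IsTransvHolSubmersionAt (y : M → ℂ) (q : M) : Prop :=
  ∀ e ∈ F.atlas, q ∈ e.source → ∃ f : ℂ → ℂ, AnalyticAt ℂ f (e q).2 ∧ deriv f (e q).2 ≠ 0 ∧
    ∀ᶠ q' in 𝓝 q, y q' = f (e q').2

/-- The restriction of the foliation to the open set `W` is holomorphically transversely additive:
`W` is covered by open sets `U_j` with transversely holomorphic submersions `y_j : U_j → ℂ`
defining the foliation, such that `y_i - y_j` is locally constant on `U_i ∩ U_j`. -/
def IsTransvAdditiveOn (W : Set M) : Prop :=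
  ∃ A : Set (Set M × (M → ℂ)),
    (∀ a ∈ A, IsOpen a.1 ∧ a.1 ⊆ W ∧ ∀ q ∈ a.1, F.IsTransvHolSubmersionAt a.2 q) ∧
    (∀ q ∈ W, ∃ a ∈ A, q ∈ a.1) ∧
    ∀ a ∈ A, ∀ b ∈ A, ∀ q ∈ a.1 ∩ b.1, ∃ c : ℂ, ∀ᶠ q' in 𝓝 q, a.2 q' = b.2 q' + c

end

end TransvHolFoliation

/-! The differentials `dy_j` of the additive structure agree on overlaps, so they define a transverse
holomorphic one-form `ω` on the complement of `Λ`, without zeros and invariant under sliding along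
the leaves (`IsAdditiveAtlas.hasCoeffAt_of_homotopy`). A compact leaf meets a transversal in a
discrete set (`Transversal.eventually_notMem_of_isCompactLeaf`), so on a transversal at a point of
`L` one has `ω = α(w) dw` with `α` holomorphic and without zeros in a punctured disc, and
`α(h(w)) h'(w) = α(w)` for every holonomy germ `h`.

Apply this to the inverse `h` of an attractor. Following orbits of `h` out to a fixed annulus shows
that `w² α(w)` is bounded (`LocalBihol.exists_bound_of_invariant`), so `α` is meromorphic, of order
`m` say; comparing leading coefficients gives `h'(0) ^ (m + 1) = 1`, hence `m = -1`
(`LocalBihol.exists_simple_pole_of_invariant`). A form with a simple pole is `c du / u` in a suitable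
coordinate `u` (`LocalBihol.exists_logDeriv_eq`). This property is constant on plaques, hence holds
on every transversal to the connected leaf `L` (`IsAdditiveAtlas.isLogarithmic_of_leaf`), whichever
point and transversal the attractor was given on. Finally a germ preserving `du / u` multiplies `u`
by a constant (`LocalBihol.comp_eq_const_mul_of_logDeriv`), so the holonomy group is linear in the
coordinate `u`, and in particular abelian. -/

/-! ### Meromorphic one-forms invariant under a germ of biholomorphism -/

namespace LocalBihol

/-- A germ fixing `0` is `w` times its difference quotient. -/
theorem toFun_eq_mul_dslope (f : LocalBihol) (w : ℂ) : f.toFun w = w * dslope f.toFun 0 w := by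
  have h := sub_smul_dslope f.toFun 0 w
  simpa [f.map_zero] using h.symm

theorem continuousAt_dslope (f : LocalBihol) : ContinuousAt (dslope f.toFun 0) 0 :=
  continuousAt_dslope_same.2 f.analyticAt.differentiableAt

theorem analyticAt_dslope (f : LocalBihol) : AnalyticAt ℂ (dslope f.toFun 0) 0 := by
  obtain ⟨p, hp⟩ := f.analyticAt
  exact hp.has_fpower_series_dslope_fslope.analyticAt

theorem dslope_zero_ne_zero (f : LocalBihol) : dslope f.toFun 0 0 ≠ 0 := by
  rw [dslope_same]; exact f.deriv_ne_zero

theorem eventually_ne_zero (f : LocalBihol) : ∀ᶠ w in 𝓝[≠] (0 : ℂ), f.toFun w ≠ 0 := by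
  filter_upwards [self_mem_nhdsWithin,
    nhdsWithin_le_nhds (f.continuousAt_dslope.eventually_ne f.dslope_zero_ne_zero)] with w h1 h2
  rw [f.toFun_eq_mul_dslope]
  exact mul_ne_zero h1 h2

theorem tendsto_punctured (f : LocalBihol) : Tendsto f.toFun (𝓝[≠] 0) (𝓝[≠] 0) :=
  tendsto_nhdsWithin_iff.2 ⟨f.tendsto.mono_left nhdsWithin_le_nhds, f.eventually_ne_zero⟩

theorem eventually_deriv_ne_zero (f : LocalBihol) : ∀ᶠ w in 𝓝 (0 : ℂ), deriv f.toFun w ≠ 0 :=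
  f.analyticAt.deriv.continuousAt.eventually_ne f.deriv_ne_zero

/-- A one-form `α(w) dw` near `0`, holomorphic away from `0` and invariant under an expanding germ
`g`, has at most a pole at `0`: the quantity `‖w² α(w)‖` does not decrease along orbits of `g`, and
these orbits leave a disc through a fixed compact annulus. -/
theorem exists_bound_of_invariant (g : LocalBihol) (hg : 1 < ‖deriv g.toFun 0‖) {α : ℂ → ℂ}
    (hα : ∀ᶠ w in 𝓝[≠] (0 : ℂ), AnalyticAt ℂ α w)
    (hinv : ∀ᶠ w in 𝓝[≠] (0 : ℂ), α (g.toFun w) * deriv g.toFun w = α w) :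
    ∃ C, ∀ᶠ w in 𝓝[≠] (0 : ℂ), ‖w ^ 2 * α w‖ ≤ C := by
  set q := dslope g.toFun 0 with hq
  set K := ‖deriv g.toFun 0‖ + 1 with hK
  obtain ⟨ρ, hρ1, hρ⟩ := exists_between hg
  have hq0 : ‖q 0‖ = ‖deriv g.toFun 0‖ := by rw [hq, dslope_same]
  have hqc : ContinuousAt (fun w => ‖q w‖) 0 := g.continuousAt_dslope.norm
  have e1 : ∀ᶠ w in 𝓝 (0 : ℂ), ρ < ‖q w‖ :=
    hqc.eventually (lt_mem_nhds (by simpa only [hq0] using hρ))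
  have e2 : ∀ᶠ w in 𝓝 (0 : ℂ), ‖q w‖ < K :=
    hqc.eventually (gt_mem_nhds (by simp only [hq0]; linarith))
  have e3 : ∀ᶠ w in 𝓝 (0 : ℂ), ‖deriv g.toFun w‖ < ‖q w‖ ^ 2 := by
    refine g.analyticAt.deriv.continuousAt.norm.eventually_lt (hqc.pow 2) ?_
    simp only [hq0]
    nlinarith
  have e4 := (eventually_nhdsWithin_iff.1 (hα.and hinv))
  obtain ⟨R, hR, hball⟩ := Metric.eventually_nhds_iff.1 (e1.and (e2.and (e3.and e4)))
  simp only [dist_zero_right] at hball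
  have hKpos : 1 < K := by linarith
  -- `g` maps the disc of radius `r` into the disc of radius `K * r < R`
  set r := R / (2 * K) with hr
  have hrpos : 0 < r := by positivity
  have hKr : K * r < R := by
    have : K * r = R / 2 := by rw [hr]; field_simp
    linarith
  have hrR : r < R := by nlinarith
  have hcpt : IsCompact (Metric.closedBall (0 : ℂ) (K * r) \ Metric.ball 0 r) :=
    (isCompact_closedBall _ _).diff Metric.isOpen_ball
  obtain ⟨C, hC⟩ := hcpt.exists_bound_of_continuousOn (f := fun w => w ^ 2 * α w) (by
    rintro w ⟨h1, h2⟩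
    simp only [Metric.mem_closedBall, Metric.mem_ball, dist_zero_right, not_lt] at h1 h2
    have hw0 : w ≠ 0 := by rintro rfl; simp at h2; linarith
    have := ((hball (y := w) (by linarith)).2.2.2 hw0).1.continuousAt
    exact ((continuousAt_id.pow 2).mul this).continuousWithinAt)
  have main : ∀ n : ℕ, ∀ w : ℂ, r / ρ ^ n ≤ ‖w‖ → ‖w‖ ≤ r → ‖w ^ 2 * α w‖ ≤ C := by
    intro n
    induction n with
    | zero =>
      intro w h1 h2
      refine hC w ⟨?_, ?_⟩
      · simp only [Metric.mem_closedBall, dist_zero_right]; nlinarith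
      · simpa using h1
    | succ n ih =>
      intro w h1 h2
      have hwpos : 0 < ‖w‖ := lt_of_lt_of_le (by positivity) h1
      obtain ⟨k1, k2, k3, k4⟩ := hball (y := w) (by linarith)
      obtain ⟨-, k5⟩ := k4 (norm_pos_iff.1 hwpos)
      have hgw : ‖g.toFun w‖ = ‖w‖ * ‖q w‖ := by rw [g.toFun_eq_mul_dslope, norm_mul]
      have step : ‖w ^ 2 * α w‖ ≤ ‖g.toFun w ^ 2 * α (g.toFun w)‖ := by
        rw [← k5]
        simp only [norm_mul, norm_pow, hgw]
        have : 0 ≤ ‖w‖ ^ 2 * ‖α (g.toFun w)‖ := by positivity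
        nlinarith
      refine step.trans ?_
      have hlow : r / ρ ^ n ≤ ‖g.toFun w‖ := by
        have h3 : r / ρ ^ (n + 1) * ρ = r / ρ ^ n := by
          have : ρ ≠ 0 := by positivity
          rw [pow_succ]
          field_simp
        rw [hgw, ← h3]
        exact mul_le_mul h1 k1.le (by positivity) (norm_nonneg _)
      rcases le_total ‖g.toFun w‖ r with h | h
      · exact ih _ hlow h
      · refine hC _ ⟨?_, ?_⟩
        · simp only [Metric.mem_closedBall, dist_zero_right, hgw]
          nlinarith [norm_nonneg (q w)]
        · simpa using h
  refine ⟨C, ?_⟩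
  filter_upwards [self_mem_nhdsWithin, nhdsWithin_le_nhds (Metric.ball_mem_nhds (0 : ℂ) hrpos)]
    with w hw0 hwr
  have hwpos : 0 < ‖w‖ := norm_pos_iff.2 hw0
  obtain ⟨n, hn⟩ := pow_unbounded_of_one_lt (r / ‖w‖) hρ1
  refine main n w ?_ (by simpa using (Metric.mem_ball.1 hwr).le)
  have : 0 < ρ ^ n := by positivity
  rw [div_le_iff₀ this]
  rw [div_lt_iff₀ hwpos] at hn
  nlinarith

/-- An invariant one-form with at most a pole has exactly a simple pole: comparing the leading
coefficients of `α(g(w)) g'(w)` and `α(w)` gives `g'(0) ^ (m + 1) = 1`, where `m` is the order of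
`α` at `0`. -/
theorem exists_simple_pole_of_invariant (g : LocalBihol) (hg : 1 < ‖deriv g.toFun 0‖) {α : ℂ → ℂ}
    (hα : ∀ᶠ w in 𝓝[≠] (0 : ℂ), AnalyticAt ℂ α w)
    (hα0 : ∀ᶠ w in 𝓝[≠] (0 : ℂ), α w ≠ 0)
    (hinv : ∀ᶠ w in 𝓝[≠] (0 : ℂ), α (g.toFun w) * deriv g.toFun w = α w) :
    ∃ v : ℂ → ℂ, AnalyticAt ℂ v 0 ∧ v 0 ≠ 0 ∧ ∀ᶠ w in 𝓝[≠] (0 : ℂ), α w = v w / w := by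
  obtain ⟨C, hC⟩ := g.exists_bound_of_invariant hg hα hinv
  -- `w ^ 3 * α w` tends to its value `0` at the origin, so its singularity is removable
  have hmer : MeromorphicAt α 0 := by
    refine ⟨3, Complex.analyticAt_of_differentiable_on_punctured_nhds_of_continuousAt ?_ ?_⟩
    · filter_upwards [hα] with w hw
      exact ((by fun_prop : DifferentiableAt ℂ (fun z : ℂ => (z - 0) ^ 3) w)).smul
        hw.differentiableAt
    · rw [continuousAt_iff_punctured_nhds]
      have h1 : Tendsto (fun w : ℂ => ‖w‖ * C) (𝓝[≠] 0) (𝓝 0) := by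
        have : Tendsto (fun w : ℂ => ‖w‖ * C) (𝓝 0) (𝓝 (‖(0 : ℂ)‖ * C)) :=
          Continuous.tendsto (by fun_prop) 0
        simpa using this.mono_left nhdsWithin_le_nhds
      have h2 : (0 - 0 : ℂ) ^ 3 • α 0 = 0 := by simp
      rw [h2]
      refine squeeze_zero_norm' ?_ h1
      filter_upwards [hC] with w hw
      have : (w - 0) ^ 3 • α w = w * (w ^ 2 * α w) := by simp; ring
      rw [this, norm_mul]
      exact mul_le_mul_of_nonneg_left hw (norm_nonneg _)
  have hord : meromorphicOrderAt α 0 ≠ ⊤ :=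
    (meromorphicOrderAt_ne_top_iff_eventually_ne_zero hmer).2 hα0
  obtain ⟨v, hv, hv0, hαv⟩ := (meromorphicOrderAt_ne_top_iff hmer).1 hord
  set m : ℤ := (meromorphicOrderAt α 0).untop₀ with hm
  simp only [sub_zero, smul_eq_mul] at hαv
  -- the leading coefficients of both sides of the invariance relation
  have hlim : dslope g.toFun 0 0 ^ m * v (g.toFun 0) * deriv g.toFun 0 = v 0 := by
    have c1 : ContinuousAt (fun w => dslope g.toFun 0 w ^ m * v (g.toFun w) * deriv g.toFun w) 0 :=
      ((g.continuousAt_dslope.zpow₀ m (Or.inl g.dslope_zero_ne_zero)).mul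
        (ContinuousAt.comp (by rw [g.map_zero]; exact hv.continuousAt)
          g.analyticAt.continuousAt)).mul g.analyticAt.deriv.continuousAt
    refine tendsto_nhds_unique (c1.tendsto.mono_left (nhdsWithin_le_nhds (s := {0}ᶜ)))
      ((hv.continuousAt.tendsto.mono_left nhdsWithin_le_nhds).congr' ?_)
    filter_upwards [self_mem_nhdsWithin, hinv, hαv, g.tendsto_punctured.eventually hαv]
      with w hw0 h1 h2 h3
    rw [h2, h3] at h1
    have hwm : w ^ m ≠ 0 := zpow_ne_zero _ hw0
    have h4 : g.toFun w ^ m = w ^ m * dslope g.toFun 0 w ^ m := by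
      rw [← mul_zpow, ← g.toFun_eq_mul_dslope]
    rw [h4] at h1
    refine mul_left_cancel₀ hwm ?_
    rw [← h1]; ring
  rw [g.map_zero, dslope_same] at hlim
  have hpow : deriv g.toFun 0 ^ (m + 1) = 1 := by
    rw [zpow_add_one₀ g.deriv_ne_zero]
    refine mul_right_cancel₀ hv0 ?_
    linear_combination hlim
  have hm1 : m + 1 = 0 := by
    have := congrArg norm hpow
    rw [norm_zpow, norm_one] at this
    exact (zpow_eq_one_iff_right₀ (norm_nonneg _) hg.ne').1 this
  have hm2 : m = -1 := by omega
  refine ⟨v, hv, hv0, ?_⟩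
  filter_upwards [hαv] with w hw
  rw [hw, hm2, zpow_neg_one]
  field_simp

/-- A one-form with a simple pole is, up to a constant, the logarithmic derivative of a local
coordinate. -/
theorem exists_logDeriv_eq {v : ℂ → ℂ} (hv : AnalyticAt ℂ v 0) (hv0 : v 0 ≠ 0) :
    ∃ u : LocalBihol, ∀ᶠ w in 𝓝[≠] (0 : ℂ), v w / w = v 0 * (deriv u.toFun w / u.toFun w) := by
  -- `u = w exp k`, where `k` is a primitive of the holomorphic part `(v w / v 0 - 1) / w`
  have hs : AnalyticAt ℂ (dslope v 0) 0 := by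
    obtain ⟨p, hp⟩ := hv
    exact hp.has_fpower_series_dslope_fslope.analyticAt
  obtain ⟨r, hr, hball⟩ := Metric.eventually_nhds_iff_ball.1 hs.eventually_analyticAt
  obtain ⟨k, hk⟩ := DifferentiableOn.isExactOn_ball (c := (0 : ℂ)) (r := r)
    (f := fun w => dslope v 0 w / v 0)
    (fun w hw => ((hball w hw).differentiableAt.div_const _).differentiableWithinAt)
  have hd : ∀ w ∈ Metric.ball (0 : ℂ) r, HasDerivAt (fun w => w * Complex.exp (k w))
      (Complex.exp (k w) * (1 + w * (dslope v 0 w / v 0))) w := fun w hw => by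
    refine ((hasDerivAt_id' w).mul (hk w hw).cexp).congr_deriv ?_
    ring
  have h0 : (0 : ℂ) ∈ Metric.ball (0 : ℂ) r := Metric.mem_ball_self hr
  have hd0 := (hd 0 h0).deriv
  refine ⟨⟨fun w => w * Complex.exp (k w), ?_, by simp, ?_⟩, ?_⟩
  · have : DifferentiableOn ℂ (fun w => w * Complex.exp (k w)) (Metric.ball 0 r) :=
      fun w hw => (hd w hw).differentiableAt.differentiableWithinAt
    exact this.analyticAt (Metric.ball_mem_nhds _ hr)
  · rw [hd0]; simp
  · filter_upwards [self_mem_nhdsWithin, nhdsWithin_le_nhds (Metric.ball_mem_nhds (0 : ℂ) hr)]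
      with w hw0 hw
    have hw0' : w ≠ 0 := hw0
    have h1 := sub_smul_dslope v 0 w
    simp only [sub_zero, smul_eq_mul] at h1
    rw [(hd w hw).deriv]
    field_simp [Complex.exp_ne_zero]
    rw [h1]; ring

/-- A germ preserving the logarithmic form `du / u` is linear in the coordinate `u`. -/
theorem comp_eq_const_mul_of_logDeriv (u g : LocalBihol)
    (h : ∀ᶠ w in 𝓝[≠] (0 : ℂ), deriv u.toFun (g.toFun w) / u.toFun (g.toFun w) * deriv g.toFun w =
      deriv u.toFun w / u.toFun w) :
    ∃ a : ℂˣ, ∀ᶠ w in 𝓝 (0 : ℂ), u.toFun (g.toFun w) = a * u.toFun w := by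
  -- the quotient `(u ∘ g) / u`, extended holomorphically across `0`, has zero derivative
  set s := u.comp g with hs
  set k : ℂ → ℂ := fun w => dslope s.toFun 0 w / dslope u.toFun 0 w with hk
  have hka : AnalyticAt ℂ k 0 := s.analyticAt_dslope.div u.analyticAt_dslope u.dslope_zero_ne_zero
  have hk0 : k 0 ≠ 0 := div_ne_zero s.dslope_zero_ne_zero u.dslope_zero_ne_zero
  have hfac : ∀ᶠ w in 𝓝 (0 : ℂ), s.toFun w = k w * u.toFun w := by
    filter_upwards [u.continuousAt_dslope.eventually_ne u.dslope_zero_ne_zero] with w hw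
    rw [s.toFun_eq_mul_dslope, u.toFun_eq_mul_dslope, hk]
    field_simp
  have hder : ∀ᶠ w in 𝓝[≠] (0 : ℂ), deriv k w = 0 := by
    filter_upwards [h, nhdsWithin_le_nhds hfac.eventually_nhds, u.eventually_ne_zero,
      g.tendsto_punctured.eventually u.eventually_ne_zero,
      nhdsWithin_le_nhds hka.eventually_analyticAt,
      nhdsWithin_le_nhds u.analyticAt.eventually_analyticAt,
      nhdsWithin_le_nhds g.analyticAt.eventually_analyticAt,
      nhdsWithin_le_nhds (g.tendsto.eventually u.analyticAt.eventually_analyticAt)]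
      with w h1 h2 h3 h4 h5 h6 h7 h8
    have d1 : HasDerivAt s.toFun (deriv u.toFun (g.toFun w) * deriv g.toFun w) w :=
      h8.differentiableAt.hasDerivAt.comp w h7.differentiableAt.hasDerivAt
    have d2 : HasDerivAt s.toFun (deriv k w * u.toFun w + k w * deriv u.toFun w) w :=
      (h5.differentiableAt.hasDerivAt.mul h6.differentiableAt.hasDerivAt).congr_of_eventuallyEq h2
    have e1 := d1.unique d2
    have e2 : u.toFun (g.toFun w) = k w * u.toFun w := h2.self_of_nhds
    field_simp at h1
    rw [e1, e2] at h1
    have : deriv k w * u.toFun w ^ 2 = 0 := by linear_combination h1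
    exact (mul_eq_zero.1 this).resolve_right (pow_ne_zero _ h3)
  have hder' : ∀ᶠ w in 𝓝 (0 : ℂ), deriv k w = 0 := by
    have hc : ContinuousAt (deriv k) 0 := hka.deriv.continuousAt
    have hz : deriv k 0 = 0 := by
      refine tendsto_nhds_unique (hc.tendsto.mono_left (nhdsWithin_le_nhds (s := {0}ᶜ))) ?_
      exact tendsto_const_nhds.congr' (hder.mono fun w hw => hw.symm)
    filter_upwards [eventually_nhdsWithin_iff.1 hder] with w hw
    by_cases h0 : w = 0
    · rw [h0, hz]
    · exact hw h0
  obtain ⟨r, hr, hball⟩ := Metric.eventually_nhds_iff_ball.1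
    (hder'.and hka.eventually_analyticAt)
  refine ⟨Units.mk0 (k 0) hk0, ?_⟩
  filter_upwards [hfac, Metric.ball_mem_nhds (0 : ℂ) hr] with w h1 h2
  have hconst : k w = k 0 := by
    refine (convex_ball (0 : ℂ) r).is_const_of_fderivWithin_eq_zero (𝕜 := ℂ)
      (fun x hx => (hball x hx).2.differentiableAt.differentiableWithinAt) (fun x hx => ?_)
      h2 (Metric.mem_ball_self hr)
    rw [fderivWithin_of_isOpen Metric.isOpen_ball hx]
    ext
    simpa using (hball x hx).1
  have h3 : s.toFun w = u.toFun (g.toFun w) := rfl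
  rw [← h3, h1, hconst]
  rfl

end LocalBihol

/-! ### Leafwise paths -/

namespace TransvHolFoliation

section

variable {ℓ : ℕ} {M : Type*} [TopologicalSpace M]
  [ChartedSpace (EuclideanSpace ℝ (Fin (ℓ + 2))) M] (F : TransvHolFoliation ℓ M)

theorem isOpen_leafTopology_slice {e : OpenPartialHomeomorph M (EuclideanSpace ℝ (Fin ℓ) × ℂ)}
    (he : e ∈ F.atlas) {V : Set M} (hV : IsOpen V) (c : ℂ) :
    IsOpen[F.leafTopology] (V ∩ e.source ∩ {q | (e q).2 = c}) :=
  TopologicalSpace.isOpen_generateFrom_of_mem ⟨e, he, V, hV, c, rfl⟩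

theorem slice_mem_nhds_leafTopology
    {e : OpenPartialHomeomorph M (EuclideanSpace ℝ (Fin ℓ) × ℂ)} (he : e ∈ F.atlas) {V : Set M}
    (hV : IsOpen V) {p : M} (hpV : p ∈ V) (hp : p ∈ e.source) :
    V ∩ e.source ∩ {q | (e q).2 = (e p).2} ∈ @nhds M F.leafTopology p :=
  @IsOpen.mem_nhds M F.leafTopology _ _ (F.isOpen_leafTopology_slice he hV (e p).2)
    ⟨⟨hpV, hp⟩, rfl⟩

theorem nhds_leafTopology_le (p : M) : @nhds M F.leafTopology p ≤ 𝓝 p := by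
  intro s hs
  obtain ⟨V, hVs, hV, hp⟩ := mem_nhds_iff.1 hs
  obtain ⟨e, he, hpe⟩ := F.cover p
  exact mem_of_superset (F.slice_mem_nhds_leafTopology he hV hp hpe) fun q hq => hVs hq.1.1

/-- The transverse coordinate is constant along a leafwise path that stays in the chart. -/
theorem coord_eq_of_continuousOn_leafTopology {c : ℝ → M} {J : Set ℝ} (hJ : IsPreconnected J)
    (hc : @ContinuousOn ℝ M _ F.leafTopology c J)
    {e : OpenPartialHomeomorph M (EuclideanSpace ℝ (Fin ℓ) × ℂ)} (he : e ∈ F.atlas)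
    (hm : MapsTo c J e.source) {s t : ℝ} (hs : s ∈ J) (ht : t ∈ J) :
    (e (c s)).2 = (e (c t)).2 := by
  refine hJ.induction₂ (fun s t => (e (c s)).2 = (e (c t)).2) (fun x hx => ?_)
    (fun _ _ _ _ _ _ h k => h.trans k) (fun _ _ _ _ h => h.symm) hs ht
  filter_upwards [hc x hx (F.slice_mem_nhds_leafTopology he isOpen_univ trivial (hm hx))] with y hy
  exact hy.2.symm

theorem isLeafwisePath_of_coord_eq {c : ℝ → M} (hc : ContinuousOn c (Icc 0 1))
    {e : OpenPartialHomeomorph M (EuclideanSpace ℝ (Fin ℓ) × ℂ)} (he : e ∈ F.atlas)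
    (hm : MapsTo c (Icc 0 1) e.source) {z : ℂ} (hz : ∀ t ∈ Icc (0 : ℝ) 1, (e (c t)).2 = z) :
    F.IsLeafwisePath c := by
  intro t ht
  refine TopologicalSpace.tendsto_nhds_generateFrom_iff.2 ?_
  rintro _ ⟨e', he', V, hV, c', rfl⟩ ⟨⟨h1, h2⟩, h3⟩
  obtain ⟨γ, -, -, hγ⟩ := F.transition e he e' he' (c t) ⟨hm ht, h2⟩
  filter_upwards [hc t ht (hV.mem_nhds h1), hc t ht (e'.open_source.mem_nhds h2), hc t ht hγ,
    self_mem_nhdsWithin] with s h4 h5 h6 hs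
  refine ⟨⟨h4, h5⟩, ?_⟩
  have h7 : (e' (c t)).2 = c' := h3
  have h6' : (e' (c s)).2 = γ (e (c s)).2 := h6
  change (e' (c s)).2 = c'
  rw [h6', hz s hs, ← hz t ht, ← h7, hγ.self_of_nhds]

theorem IsLeafwisePath.mem_of_mem {F : TransvHolFoliation ℓ M} {c : ℝ → M}
    (hc : F.IsLeafwisePath c) {L : Set M} (hL : F.IsLeaf L) {s t : ℝ} (hs : s ∈ Icc (0 : ℝ) 1)
    (ht : t ∈ Icc (0 : ℝ) 1) (h : c s ∈ L) : c t ∈ L := by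
  obtain ⟨p, rfl⟩ := hL
  have h1 := @IsPreconnected.image _ _ _ F.leafTopology _ isPreconnected_Icc c hc
  have h2 := @IsPreconnected.subset_connectedComponent M F.leafTopology _ _ h1
    (mem_image_of_mem c hs)
  have h3 : F.leaf p = @connectedComponent M F.leafTopology (c s) :=
    @connectedComponent_eq M F.leafTopology _ _ h
  rw [h3]
  exact h2 (mem_image_of_mem c ht)

/-- A set is saturated if leafwise paths starting in it stay in it. -/
def IsSaturated (W : Set M) : Prop :=
  ∀ c : ℝ → M, F.IsLeafwisePath c → c 0 ∈ W → ∀ t ∈ Icc (0 : ℝ) 1, c t ∈ W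

theorem isSaturated_compl_sUnion {S : Set (Set M)} (hS : ∀ L ∈ S, F.IsLeaf L) :
    F.IsSaturated (⋃₀ S)ᶜ := by
  rintro c hc h0 t ht ⟨L, hL, htL⟩
  exact h0 ⟨L, hL, hc.mem_of_mem (hS L hL) ht ⟨le_rfl, zero_le_one⟩ htL⟩

/-! ### Transversals -/

variable {F} in
/-- The transverse coordinate of a foliated chart at `p` along a transversal at `p`, translated so
that it vanishes at `p`. -/
noncomputable def Transversal.coord {p : M} (τ : F.Transversal p)
    {e : OpenPartialHomeomorph M (EuclideanSpace ℝ (Fin ℓ) × ℂ)} (he : e ∈ F.atlas)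
    (hp : p ∈ e.source) : LocalBihol where
  toFun w := (e (τ.toFun w)).2 - (e p).2
  analyticAt := (τ.holomorphic e he hp).1.sub analyticAt_const
  map_zero := by simp [τ.map_zero]
  deriv_ne_zero := by
    rw [deriv_sub_const]
    exact (τ.holomorphic e he hp).2

theorem Transversal.eventually_continuousAt {F : TransvHolFoliation ℓ M} {p : M}
    (τ : F.Transversal p) : ∀ᶠ w in 𝓝 (0 : ℂ), ContinuousAt τ.toFun w :=
  τ.smooth.mono fun _ h => ContMDiffAt.continuousAt h

theorem Transversal.tendsto {F : TransvHolFoliation ℓ M} {p : M}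
    (τ : F.Transversal p) : Tendsto τ.toFun (𝓝 0) (𝓝 p) := by
  have := τ.eventually_continuousAt.self_of_nhds.tendsto
  rwa [τ.map_zero] at this

/-- The slices `x = const` of a foliated chart are transversals. -/
theorem nonempty_transversal (p : M) : Nonempty (F.Transversal p) := by
  obtain ⟨e, he, hp⟩ := F.cover p
  set i : ℂ → EuclideanSpace ℝ (Fin ℓ) × ℂ := fun w => ((e p).1, (e p).2 + w) with hi
  have hic : Continuous i := by fun_prop
  have hi0 : i 0 = e p := by simp [hi]
  have htar : ∀ᶠ w in 𝓝 (0 : ℂ), i w ∈ e.target :=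
    hic.continuousAt.eventually (e.open_target.mem_nhds (by rw [hi0]; exact e.map_source hp))
  have hsm : ContMDiff 𝓘(ℝ, ℂ) 𝓘(ℝ, EuclideanSpace ℝ (Fin ℓ) × ℂ) ∞ i :=
    (contDiff_const.prodMk (contDiff_const.add contDiff_id)).contMDiff
  have ht : Tendsto (fun w => e.symm (i w)) (𝓝 0) (𝓝 p) := by
    have h1 := (e.continuousAt_symm (e.map_source hp)).tendsto
    rw [e.left_inv hp, ← hi0] at h1
    exact h1.comp hic.continuousAt
  refine ⟨⟨fun w => e.symm (i w), by simp [hi0, e.left_inv hp], ?_, fun e' he' hp' => ?_⟩⟩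
  · filter_upwards [htar] with w hw
    exact ContMDiffAt.comp w ((F.smooth_symm e he).contMDiffAt (e.open_target.mem_nhds hw))
      hsm.contMDiffAt
  · obtain ⟨γ, hγ, hγ', h⟩ := F.transition e he e' he' p ⟨hp, hp'⟩
    have heq : (fun w => (e' (e.symm (i w))).2) =ᶠ[𝓝 0] fun w => γ ((e p).2 + w) := by
      filter_upwards [ht.eventually h, htar] with w h1 h2
      rw [h1, e.right_inv h2]
    refine ⟨AnalyticAt.congr ?_ heq.symm, ?_⟩
    · exact AnalyticAt.fun_comp (by simpa using hγ) (analyticAt_const.add analyticAt_id)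
    · rw [heq.deriv_eq, deriv_comp_const_add]
      simpa using hγ'

/-- A compact leaf meets a transversal in a discrete set. The leaf topology, for which the leaf is
compact, is finer than that of `M`: intersection points accumulating at `p` accumulate at `p` in
the leaf topology too, hence lie in the plaque of `p`, on which the transverse coordinate is
constant. -/
theorem Transversal.eventually_notMem_of_isCompactLeaf {F : TransvHolFoliation ℓ M} [T2Space M]
    {p : M} (τ : F.Transversal p) {K : Set M} (hK : F.IsCompactLeaf K) :
    ∀ᶠ w in 𝓝[≠] (0 : ℂ), τ.toFun w ∉ K := by
  by_contra hcon
  have hfr : ∃ᶠ w in 𝓝[≠] (0 : ℂ), τ.toFun w ∈ K := hcon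
  have hne := frequently_iff_neBot.1 hfr
  set G := map τ.toFun (𝓝[≠] (0 : ℂ) ⊓ 𝓟 {w | τ.toFun w ∈ K}) with hG
  have hGne : G.NeBot := hne.map _
  have hGK : G ≤ 𝓟 K := by
    rw [hG, le_principal_iff, mem_map]
    exact mem_inf_of_right (mem_principal_self _)
  obtain ⟨k, -, hk⟩ := hK.2 hGK
  have hGp : G ≤ 𝓝 p := fun s hs =>
    mem_inf_of_left (mem_nhdsWithin_of_mem_nhds (τ.tendsto hs))
  have hkp : k = p := by
    have h1 : (@nhds M F.leafTopology k ⊓ G).NeBot := hk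
    have h2 : (𝓝 k ⊓ 𝓝 p).NeBot := h1.mono (inf_le_inf (F.nhds_leafTopology_le k) hGp)
    exact eq_of_nhds_neBot h2
  subst hkp
  obtain ⟨e, he, hp⟩ := F.cover k
  have hS := F.slice_mem_nhds_leafTopology he isOpen_univ trivial hp
  have hSc : {q | (e q).2 ≠ (e k).2} ∈ G := by
    refine mem_inf_of_left ?_
    filter_upwards [(τ.coord he hp).eventually_ne_zero] with w hw
    exact sub_ne_zero.1 hw
  have h1 : (@nhds M F.leafTopology k ⊓ G).NeBot := hk
  have h2 := inter_mem_inf hS hSc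
  obtain ⟨q, hq1, hq2⟩ := h1.nonempty_of_mem h2
  exact hq2 hq1.2

end

end TransvHolFoliation

/-! ### Multipliers and linearizable groups of germs -/

namespace DiffGerm

theorem multiplier_ne_zero (g : DiffGerm) : g.multiplier ≠ 0 := by
  induction g using Quotient.inductionOn with
  | h f => exact f.deriv_ne_zero

theorem multiplier_mul (f g : DiffGerm) : (f * g).multiplier = f.multiplier * g.multiplier := by
  induction f using Quotient.inductionOn with
  | h f =>
    induction g using Quotient.inductionOn with
    | h g =>
      change deriv (f.toFun ∘ g.toFun) 0 = deriv f.toFun 0 * deriv g.toFun 0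
      rw [deriv_comp (0 : ℂ) (by rw [g.map_zero]; exact f.analyticAt.differentiableAt)
        g.analyticAt.differentiableAt, g.map_zero]

theorem multiplier_one : (1 : DiffGerm).multiplier = 1 := by
  change deriv (fun z : ℂ => ((1 : ℂˣ) : ℂ) * z) 0 = 1
  simp

theorem multiplier_inv (g : DiffGerm) : (g⁻¹).multiplier = g.multiplier⁻¹ :=
  eq_inv_of_mul_eq_one_left (by rw [← multiplier_mul, inv_mul_cancel, multiplier_one])

theorem linear_mul_linear (a b : ℂˣ) : linear a * linear b = linear (a * b) :=
  mk_eq_mk.2 (Eventually.of_forall fun z => by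
    simp [LocalBihol.comp, LocalBihol.linear, mul_assoc])

theorem IsLinearizable.isMulCommutative {G : Subgroup DiffGerm} (hG : IsLinearizable G) :
    IsMulCommutative G := by
  obtain ⟨φ, hφ⟩ := hG
  refine ⟨⟨fun f g => Subtype.ext ?_⟩⟩
  obtain ⟨a, ha⟩ := hφ f f.2
  obtain ⟨b, hb⟩ := hφ g g.2
  have h : φ * (f * g : DiffGerm) * φ⁻¹ = φ * (g * f : DiffGerm) * φ⁻¹ := by
    calc φ * (f * g : DiffGerm) * φ⁻¹ = (φ * f * φ⁻¹) * (φ * g * φ⁻¹) := by group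
      _ = (φ * g * φ⁻¹) * (φ * f * φ⁻¹) := by
        rw [ha, hb, linear_mul_linear, linear_mul_linear, mul_comm]
      _ = φ * (g * f : DiffGerm) * φ⁻¹ := by group
  exact mul_left_cancel (mul_right_cancel h)

end DiffGerm

/-! ### The transverse one-form of an additive structure -/

namespace TransvHolFoliation

section

variable {ℓ : ℕ} {M : Type*} [TopologicalSpace M]
  [ChartedSpace (EuclideanSpace ℝ (Fin (ℓ + 2))) M] (F : TransvHolFoliation ℓ M)

/-- The family `A` of pairs `(U_j, y_j)` is a transversely additive structure on `W`. -/
structure IsAdditiveAtlas (W : Set M) (A : Set (Set M × (M → ℂ))) : Prop where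
  isOpen : ∀ a ∈ A, IsOpen a.1
  subset : ∀ a ∈ A, a.1 ⊆ W
  submersion : ∀ a ∈ A, ∀ q ∈ a.1, F.IsTransvHolSubmersionAt a.2 q
  cover : ∀ q ∈ W, ∃ a ∈ A, q ∈ a.1
  sub_const : ∀ a ∈ A, ∀ b ∈ A, ∀ q ∈ a.1 ∩ b.1, ∃ c : ℂ, ∀ᶠ q' in 𝓝 q, a.2 q' = b.2 q' + c

/-- The differentials `dy_j` of an additive structure agree on overlaps, so that they define a
transverse one-form. `HasCoeffAt A σ w a` says that its pull-back by `σ : ℂ → M` is `a dw` at the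
point `w` (which entails that `σ w` is in the domain of the structure). -/
def HasCoeffAt (A : Set (Set M × (M → ℂ))) (σ : ℂ → M) (w a : ℂ) : Prop :=
  ContinuousAt σ w ∧ ∃ b ∈ A, σ w ∈ b.1 ∧ HasDerivAt (b.2 ∘ σ) a w

variable {F} {W : Set M} {A : Set (Set M × (M → ℂ))}

theorem HasCoeffAt.congr {σ σ' : ℂ → M} {w a : ℂ} (h : HasCoeffAt A σ w a)
    (hσ : σ =ᶠ[𝓝 w] σ') : HasCoeffAt A σ' w a := by
  obtain ⟨h1, b, hb, hwb, h2⟩ := h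
  exact ⟨h1.congr hσ, b, hb, hσ.self_of_nhds ▸ hwb,
    h2.congr_of_eventuallyEq (hσ.symm.fun_comp b.2)⟩

theorem HasCoeffAt.comp {σ : ℂ → M} {h : ℂ → ℂ} {w a h' : ℂ} (hσ : HasCoeffAt A σ (h w) a)
    (hh : HasDerivAt h h' w) : HasCoeffAt A (σ ∘ h) w (a * h') := by
  obtain ⟨h1, b, hb, hwb, h2⟩ := hσ
  exact ⟨h1.comp hh.continuousAt, b, hb, hwb, h2.comp w hh⟩

theorem IsAdditiveAtlas.hasDerivAt (hA : F.IsAdditiveAtlas W A) {σ : ℂ → M} {w a : ℂ}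
    (h : HasCoeffAt A σ w a) {b : Set M × (M → ℂ)} (hb : b ∈ A) (hwb : σ w ∈ b.1) :
    HasDerivAt (b.2 ∘ σ) a w := by
  obtain ⟨h1, b', hb', hwb', h2⟩ := h
  obtain ⟨c, hc⟩ := hA.sub_const b hb b' hb' (σ w) ⟨hwb, hwb'⟩
  exact (h2.add_const c).congr_of_eventuallyEq (h1.eventually hc)

theorem IsAdditiveAtlas.coeff_unique (hA : F.IsAdditiveAtlas W A) {σ : ℂ → M} {w a a' : ℂ}
    (h : HasCoeffAt A σ w a) (h' : HasCoeffAt A σ w a') : a = a' := by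
  obtain ⟨-, b, hb, hwb, h2⟩ := h'
  exact (hA.hasDerivAt h hb hwb).unique h2

/-- The transverse one-form is invariant under sliding along the leaves. -/
theorem IsAdditiveAtlas.hasCoeffAt_of_homotopy (hA : F.IsAdditiveAtlas W A)
    (hsat : F.IsSaturated W) {U : Set ℂ} (hU : IsOpen U) {H : ℝ × ℂ → M}
    (hH : ContinuousOn H (Icc 0 1 ×ˢ U)) (hl : ∀ w ∈ U, F.IsLeafwisePath fun t => H (t, w))
    {w a : ℂ} (hw : w ∈ U) (h : HasCoeffAt A (fun w => H (0, w)) w a) :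
    HasCoeffAt A (fun w => H (1, w)) w a := by
  have hW : ∀ t ∈ Icc (0 : ℝ) 1, H (t, w) ∈ W := by
    obtain ⟨-, b, hb, hwb, -⟩ := h
    exact hsat _ (hl w hw) (hA.subset b hb hwb)
  have hcont : ∀ t ∈ Icc (0 : ℝ) 1, ContinuousAt (fun w => H (t, w)) w := fun t ht =>
    (hH.comp (f := fun w => (t, w)) (by fun_prop) fun w' hw' => ⟨ht, hw'⟩).continuousAt
      (hU.mem_nhds hw)
  -- in a foliated chart the function `y_j` depends on the transverse coordinate only, which is
  -- constant along the paths `H (·, w')` as long as they stay in the chart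
  suffices key : ∀ t ∈ Icc (0 : ℝ) 1, ∀ᶠ s in 𝓝[Icc 0 1] t,
      (HasCoeffAt A (fun w => H (t, w)) w a ↔ HasCoeffAt A (fun w => H (s, w)) w a) from
    (isPreconnected_Icc.induction₂ (fun t s => HasCoeffAt A (fun w => H (t, w)) w a ↔
      HasCoeffAt A (fun w => H (s, w)) w a) key (fun _ _ _ _ _ _ h k => h.trans k)
      (fun _ _ _ _ h => h.symm) ⟨le_rfl, zero_le_one⟩ ⟨zero_le_one, le_rfl⟩).1 h
  intro t ht
  obtain ⟨b, hb, htb⟩ := hA.cover _ (hW t ht)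
  obtain ⟨e, he, hte⟩ := F.cover (H (t, w))
  obtain ⟨f, -, -, hf⟩ := hA.submersion b hb _ htb e he hte
  have hN : ∀ᶠ q in 𝓝 (H (t, w)), q ∈ b.1 ∧ q ∈ e.source ∧ b.2 q = f (e q).2 :=
    ((hA.isOpen b hb).eventually_mem htb).and ((e.open_source.eventually_mem hte).and hf)
  have hN' := hH (t, w) ⟨ht, hw⟩ hN
  rw [nhdsWithin_prod_eq, hU.nhdsWithin_eq hw] at hN'
  obtain ⟨P, hP, Q, hQ, hPQ⟩ := eventually_prod_iff.1 hN'
  obtain ⟨δ, hδ, hball⟩ := Metric.mem_nhdsWithin_iff.1 hP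
  set J := Metric.ball t δ ∩ Icc (0 : ℝ) 1 with hJ
  have hJc : IsPreconnected J := ((convex_ball t δ).inter (convex_Icc 0 1)).isPreconnected
  have htJ : t ∈ J := ⟨Metric.mem_ball_self hδ, ht⟩
  filter_upwards [inter_mem (mem_nhdsWithin_of_mem_nhds (Metric.ball_mem_nhds t hδ))
    self_mem_nhdsWithin] with s hs
  have hsJ : s ∈ J := hs
  have heq : b.2 ∘ (fun w => H (t, w)) =ᶠ[𝓝 w] b.2 ∘ fun w => H (s, w) := by
    filter_upwards [hQ, hU.mem_nhds hw] with w' hw' hw'U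
    have h1 : b.2 (H (t, w')) = f (e (H (t, w'))).2 := (hPQ (hball htJ) hw').2.2
    have h2 : b.2 (H (s, w')) = f (e (H (s, w'))).2 := (hPQ (hball hsJ) hw').2.2
    have h3 := F.coord_eq_of_continuousOn_leafTopology hJc
      (@ContinuousOn.mono ℝ M _ F.leafTopology _ _ _ (hl w' hw'U) inter_subset_right) he
      (fun r hr => (hPQ (hball hr) hw').2.1) htJ hsJ
    simp only [Function.comp_apply]
    rw [h1, h2, h3]
  have hsb : H (s, w) ∈ b.1 := (hPQ (hball hsJ) hQ.self_of_nhds).1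
  constructor
  · intro h
    exact ⟨hcont s hs.2, b, hb, hsb, (hA.hasDerivAt h hb htb).congr_of_eventuallyEq heq.symm⟩
  · intro h
    exact ⟨hcont t ht, b, hb, htb, (hA.hasDerivAt h hb hsb).congr_of_eventuallyEq heq⟩

/-- On a transversal that meets the complement of `W` at most at its base point, the transverse
one-form is `α(w) dw` with `α` holomorphic and without zeros away from the base point. -/
theorem IsAdditiveAtlas.exists_coeff (hA : F.IsAdditiveAtlas W A) {p : M} (τ : F.Transversal p)
    (hW : ∀ᶠ w in 𝓝[≠] (0 : ℂ), τ.toFun w ∈ W) :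
    ∃ α : ℂ → ℂ, ∀ᶠ w in 𝓝[≠] (0 : ℂ), AnalyticAt ℂ α w ∧ α w ≠ 0 ∧
      HasCoeffAt A τ.toFun w (α w) := by
  obtain ⟨e, he, hp⟩ := F.cover p
  set ζ := τ.coord he hp with hζ
  -- the coefficient, chosen at each point; it is unique, so locally it is `d y_j / dw`
  set α : ℂ → ℂ := fun w => Classical.epsilon fun a => HasCoeffAt A τ.toFun w a
  refine ⟨α, ?_⟩
  filter_upwards [hW, nhdsWithin_le_nhds τ.eventually_continuousAt.eventually_nhds,
    nhdsWithin_le_nhds ζ.analyticAt.eventually_analyticAt,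
    nhdsWithin_le_nhds ζ.eventually_deriv_ne_zero,
    nhdsWithin_le_nhds (τ.tendsto.eventually (e.open_source.mem_nhds hp))]
    with w h1 h2 h3 h4 h5
  obtain ⟨b, hb, hwb⟩ := hA.cover _ h1
  obtain ⟨f, hf, hf', hfe⟩ := hA.submersion b hb _ hwb e he h5
  have hcw : ContinuousAt τ.toFun w := h2.self_of_nhds
  set Z : ℂ → ℂ := fun w => (e (τ.toFun w)).2 with hZdef
  have hZeq : Z = fun w => ζ.toFun w + (e p).2 := by
    funext w
    change Z w = (e (τ.toFun w)).2 - (e p).2 + (e p).2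
    simp [hZdef]
  have hZ : AnalyticAt ℂ Z w := by rw [hZeq]; exact h3.add analyticAt_const
  change AnalyticAt ℂ f (Z w) at hf
  change deriv f (Z w) ≠ 0 at hf'
  have hZ' : deriv Z w ≠ 0 := by rw [hZeq, deriv_add_const]; exact h4
  have hy : b.2 ∘ τ.toFun =ᶠ[𝓝 w] f ∘ Z := hcw.eventually hfe
  have hya : AnalyticAt ℂ (b.2 ∘ τ.toFun) w := (AnalyticAt.comp hf hZ).congr hy.symm
  have hcoeff : ∀ᶠ w' in 𝓝 w, HasCoeffAt A τ.toFun w' (deriv (b.2 ∘ τ.toFun) w') := by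
    filter_upwards [h2, hcw.eventually ((hA.isOpen b hb).mem_nhds hwb), hya.eventually_analyticAt]
      with w' k1 k2 k3
    exact ⟨k1, b, hb, k2, k3.differentiableAt.hasDerivAt⟩
  have hα : deriv (b.2 ∘ τ.toFun) =ᶠ[𝓝 w] α := by
    filter_upwards [hcoeff] with w' hw'
    exact hA.coeff_unique hw' (Classical.epsilon_spec (p := fun a => HasCoeffAt A τ.toFun w' a)
      ⟨_, hw'⟩)
  refine ⟨hya.deriv.congr hα, ?_, ?_⟩
  · rw [← hα.self_of_nhds, hy.deriv_eq, deriv_comp w hf.differentiableAt hZ.differentiableAt]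
    exact mul_ne_zero hf' hZ'
  · have := hcoeff.self_of_nhds
    rwa [hα.self_of_nhds] at this

/-- The holonomy of the foliation preserves the transverse one-form. -/
theorem IsAdditiveAtlas.invariant_of_isHolonomyOf (hA : F.IsAdditiveAtlas W A)
    (hsat : F.IsSaturated W) {p : M} {τ : F.Transversal p} {γ : ℝ → M} {g : DiffGerm}
    (hg : F.IsHolonomyOf τ γ g) : ∃ h : LocalBihol, DiffGerm.mk h = g ∧ ∀ α : ℂ → ℂ,
      (∀ᶠ w in 𝓝[≠] (0 : ℂ), HasCoeffAt A τ.toFun w (α w)) →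
        ∀ᶠ w in 𝓝[≠] (0 : ℂ), α (h.toFun w) * deriv h.toFun w = α w := by
  obtain ⟨h, hhg, U, hU, hU0, H, hH, -, hHl⟩ := hg
  refine ⟨h, hhg, fun α hα => ?_⟩
  filter_upwards [hα, h.tendsto_punctured.eventually hα, nhdsWithin_le_nhds (hU.mem_nhds hU0),
    nhdsWithin_le_nhds h.analyticAt.eventually_analyticAt] with w h1 h2 hw h3
  have e0 : τ.toFun =ᶠ[𝓝 w] fun w => H (0, w) := by
    filter_upwards [hU.mem_nhds hw] with w' hw'
    exact (hHl w' hw').2.1.symm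
  have e1 : (fun w => H (1, w)) =ᶠ[𝓝 w] τ.toFun ∘ h.toFun := by
    filter_upwards [hU.mem_nhds hw] with w' hw'
    exact (hHl w' hw').2.2
  have h4 := (hA.hasCoeffAt_of_homotopy hsat hU hH (fun w hw => (hHl w hw).1) hw
    (h1.congr e0)).congr e1
  exact hA.coeff_unique (h2.comp h3.differentiableAt.hasDerivAt) h4

/-! ### Logarithmic forms and their transport along a leaf -/

variable (A) in
/-- The transverse one-form is `c du / u` on the transversal `τ`, for a holomorphic coordinate `u`
centred at the base point and a constant `c ≠ 0`. -/
def IsLogarithmic {p : M} (τ : F.Transversal p) : Prop :=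
  ∃ u : LocalBihol, ∃ c : ℂ, c ≠ 0 ∧
    ∀ᶠ w in 𝓝[≠] (0 : ℂ), HasCoeffAt A τ.toFun w (c * (deriv u.toFun w / u.toFun w))

/-- Transversals at two points of the same plaque are identified by sliding along the plaques,
which carries logarithmic forms to logarithmic forms. -/
theorem IsAdditiveAtlas.isLogarithmic_of_plaque (hA : F.IsAdditiveAtlas W A)
    (hsat : F.IsSaturated W) {e : OpenPartialHomeomorph M (EuclideanSpace ℝ (Fin ℓ) × ℂ)}
    (he : e ∈ F.atlas) {x : EuclideanSpace ℝ (Fin ℓ) × ℂ} {r : ℝ}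
    (hr : Metric.ball x r ⊆ e.target) {p q : M} (hp : p ∈ e.source) (hq : q ∈ e.source)
    (hpr : e p ∈ Metric.ball x r) (hqr : e q ∈ Metric.ball x r) (hpq : (e p).2 = (e q).2)
    {τ : F.Transversal p} (τ' : F.Transversal q) (h : IsLogarithmic A τ) :
    IsLogarithmic A τ' := by
  obtain ⟨u, c, hc, hu⟩ := h
  -- `φ` matches the points of `τ'` and `τ` that lie in the same plaque
  set ζ := τ.coord he hp with hζ
  set ζ' := τ'.coord he hq with hζ'
  set φ := ζ.inverse.comp ζ' with hφ
  have hcoord : ∀ᶠ w in 𝓝 (0 : ℂ), (e (τ.toFun (φ.toFun w))).2 = (e (τ'.toFun w)).2 := by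
    filter_upwards [ζ'.tendsto.eventually ζ.inverse_right] with w hw
    have : (e (τ.toFun (φ.toFun w))).2 - (e p).2 = (e (τ'.toFun w)).2 - (e q).2 := hw
    rw [hpq] at this
    exact sub_left_injective this
  have hbox : ∀ {o : M}, o ∈ e.source → e o ∈ Metric.ball x r →
      ∀ᶠ q in 𝓝 o, q ∈ e.source ∧ e q ∈ Metric.ball x r := fun ho hox =>
    (e.open_source.eventually_mem ho).and
      ((e.continuousAt ho).eventually (Metric.isOpen_ball.mem_nhds hox))
  have htφ : Tendsto (fun w => τ.toFun (φ.toFun w)) (𝓝 0) (𝓝 p) := τ.tendsto.comp φ.tendsto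
  obtain ⟨U, hUs, hU, hU0⟩ := mem_nhds_iff.1 (hcoord.and ((htφ.eventually (hbox hp hpr)).and
    ((τ'.tendsto.eventually (hbox hq hqr)).and (τ'.eventually_continuousAt.and
      ((φ.tendsto.eventually τ.eventually_continuousAt).and
        φ.analyticAt.eventually_analyticAt)))))
  set X : ℝ × ℂ → EuclideanSpace ℝ (Fin ℓ) × ℂ := fun y =>
    (1 - y.1) • e (τ.toFun (φ.toFun y.2)) + y.1 • e (τ'.toFun y.2) with hX
  have hXball : ∀ t ∈ Icc (0 : ℝ) 1, ∀ w ∈ U, X (t, w) ∈ Metric.ball x r := by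
    rintro t ⟨ht0, ht1⟩ w hw
    obtain ⟨-, k2, k3, -⟩ := hUs hw
    exact convex_ball x r k2.2 k3.2 (by linarith) ht0 (by ring)
  have hXtar : MapsTo X (Icc 0 1 ×ˢ U) e.target := fun y hy => hr (hXball y.1 hy.1 y.2 hy.2)
  have hXsnd : ∀ t, ∀ w ∈ U, (X (t, w)).2 = (e (τ'.toFun w)).2 := by
    intro t w hw
    have k1 : (e (τ.toFun (φ.toFun w))).2 = (e (τ'.toFun w)).2 := (hUs hw).1
    simp only [hX, Prod.snd_add, Prod.smul_snd, k1]
    rw [← add_smul]; simp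
  have hXcont : ContinuousOn X (Icc 0 1 ×ˢ U) := by
    have c1 : ContinuousOn (fun w => e (τ.toFun (φ.toFun w))) U := fun w hw => by
      obtain ⟨-, k2, -, -, k5, k6⟩ := hUs hw
      exact ((e.continuousAt k2.1).comp (f := fun w => τ.toFun (φ.toFun w))
        (k5.comp k6.continuousAt)).continuousWithinAt
    have c2 : ContinuousOn (fun w => e (τ'.toFun w)) U := fun w hw => by
      obtain ⟨-, -, k3, k4, -⟩ := hUs hw
      exact ((e.continuousAt k3.1).comp k4).continuousWithinAt
    have c3 := c1.comp (continuousOn_snd (s := Icc (0 : ℝ) 1 ×ˢ U)) fun y hy => hy.2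
    have c4 := c2.comp (continuousOn_snd (s := Icc (0 : ℝ) 1 ×ˢ U)) fun y hy => hy.2
    exact (((continuousOn_const.sub continuousOn_fst).smul c3).add (continuousOn_fst.smul c4))
  -- the straight-line homotopy in the chart from `τ ∘ φ` to `τ'`
  set H : ℝ × ℂ → M := fun y => e.symm (X y) with hH
  have hHcont : ContinuousOn H (Icc 0 1 ×ˢ U) := e.continuousOn_symm.comp hXcont hXtar
  have hHl : ∀ w ∈ U, F.IsLeafwisePath fun t => H (t, w) := fun w hw =>
    F.isLeafwisePath_of_coord_eq
      (hHcont.comp (f := fun t : ℝ => (t, w)) (by fun_prop) fun t ht => ⟨ht, hw⟩) he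
      (fun t ht => e.map_target (hXtar (x := (t, w)) ⟨ht, hw⟩))
      (z := (e (τ'.toFun w)).2) fun t ht => by
        rw [hH]
        simp only
        rw [e.right_inv (hXtar (x := (t, w)) ⟨ht, hw⟩), hXsnd t w hw]
  refine ⟨u.comp φ, c, hc, ?_⟩
  filter_upwards [φ.tendsto_punctured.eventually hu, nhdsWithin_le_nhds (hU.mem_nhds hU0),
    nhdsWithin_le_nhds (φ.tendsto.eventually u.analyticAt.eventually_analyticAt)] with w h1 hw h2
  have k6 : AnalyticAt ℂ φ.toFun w := (hUs hw).2.2.2.2.2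
  have e0 : τ.toFun ∘ φ.toFun =ᶠ[𝓝 w] fun w => H (0, w) := by
    filter_upwards [hU.mem_nhds hw] with w' hw'
    have := (hUs hw').2.1.1
    simp [hH, hX, e.left_inv this]
  have e1 : (fun w => H (1, w)) =ᶠ[𝓝 w] τ'.toFun := by
    filter_upwards [hU.mem_nhds hw] with w' hw'
    have := (hUs hw').2.2.1.1
    simp [hH, hX, e.left_inv this]
  have h3 := (hA.hasCoeffAt_of_homotopy hsat hU hHcont hHl hw
    ((h1.comp k6.differentiableAt.hasDerivAt).congr e0)).congr e1
  have h4 : deriv (u.comp φ).toFun w = deriv u.toFun (φ.toFun w) * deriv φ.toFun w :=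
    deriv_comp w h2.differentiableAt k6.differentiableAt
  have h5 : (u.comp φ).toFun w = u.toFun (φ.toFun w) := rfl
  rw [h4, h5]
  convert h3 using 1
  ring

/-- If the transverse one-form is logarithmic on one transversal to a leaf, it is so on all
transversals to this leaf: the condition is constant on plaques and the leaf is connected. -/
theorem IsAdditiveAtlas.isLogarithmic_of_leaf (hA : F.IsAdditiveAtlas W A)
    (hsat : F.IsSaturated W) {L : Set M} (hL : F.IsLeaf L) {p q : M} (hp : p ∈ L) (hq : q ∈ L)
    {τ : F.Transversal p} (h : IsLogarithmic A τ) (τ' : F.Transversal q) :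
    IsLogarithmic A τ' := by
  have hconn : @IsPreconnected M F.leafTopology L := by
    obtain ⟨o, rfl⟩ := hL
    exact @isPreconnected_connectedComponent M F.leafTopology o
  have hbox : ∀ o : M, ∃ e ∈ F.atlas, o ∈ e.source ∧ ∃ r > 0, Metric.ball (e o) r ⊆ e.target := by
    intro o
    obtain ⟨e, he, ho⟩ := F.cover o
    obtain ⟨r, hr, hball⟩ := Metric.isOpen_iff.1 e.open_target _ (e.map_source ho)
    exact ⟨e, he, ho, r, hr, hball⟩
  have key := @IsPreconnected.induction₂ M F.leafTopology L hconn
    (fun a b => (∀ σ : F.Transversal a, IsLogarithmic A σ) ↔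
      ∀ σ : F.Transversal b, IsLogarithmic A σ) (fun a _ => by
      obtain ⟨e, he, ha, r, hr, hball⟩ := hbox a
      have hmem := F.slice_mem_nhds_leafTopology he
        (e.isOpen_inter_preimage (Metric.isOpen_ball (x := e a) (ε := r)))
        ⟨ha, Metric.mem_ball_self hr⟩ ha
      refine mem_of_superset (@mem_nhdsWithin_of_mem_nhds M F.leafTopology _ _ _ hmem) ?_
      rintro b ⟨⟨⟨hb, hbr⟩, -⟩, hab⟩
      obtain ⟨σa⟩ := F.nonempty_transversal a
      obtain ⟨σb⟩ := F.nonempty_transversal b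
      exact ⟨fun k σ => hA.isLogarithmic_of_plaque hsat he hball ha hb (Metric.mem_ball_self hr)
          hbr hab.symm σ (k σa),
        fun k σ => hA.isLogarithmic_of_plaque hsat he hball hb ha hbr (Metric.mem_ball_self hr)
          hab σ (k σb)⟩)
    (fun _ _ _ _ _ _ h k => h.trans k) (fun _ _ _ _ h => h.symm) p q hp hq
  refine key.1 (fun σ => ?_) τ'
  obtain ⟨e, he, ho, r, hr, hball⟩ := hbox p
  exact hA.isLogarithmic_of_plaque hsat he hball ho ho (Metric.mem_ball_self hr)
    (Metric.mem_ball_self hr) rfl σ h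

/-! ### Linearization of the holonomy group -/

/-- An attractor in the holonomy group computed on `τ` makes the transverse one-form logarithmic
on `τ`. -/
theorem IsAdditiveAtlas.isLogarithmic_of_attractor (hA : F.IsAdditiveAtlas W A)
    (hsat : F.IsSaturated W) {p : M} (τ : F.Transversal p)
    (hW : ∀ᶠ w in 𝓝[≠] (0 : ℂ), τ.toFun w ∈ W) {g : DiffGerm} (hg : g ∈ F.holonomyGroup τ)
    (hattr : g.IsHyperbolicAttractor) : IsLogarithmic A τ := by
  obtain ⟨α, hα⟩ := hA.exists_coeff τ hW
  obtain ⟨γ, -, -, -, hγ⟩ := (F.holonomyGroup τ).inv_mem hg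
  obtain ⟨h, hh, hinv⟩ := hA.invariant_of_isHolonomyOf hsat hγ
  have hexp : 1 < ‖deriv h.toFun 0‖ := by
    change 1 < ‖(DiffGerm.mk h).multiplier‖
    rw [hh, DiffGerm.multiplier_inv, norm_inv]
    exact (one_lt_inv₀ (norm_pos_iff.2 g.multiplier_ne_zero)).2 hattr
  obtain ⟨v, hv, hv0, hαv⟩ := h.exists_simple_pole_of_invariant hexp (hα.mono fun _ k => k.1)
    (hα.mono fun _ k => k.2.1) (hinv α (hα.mono fun _ k => k.2.2))
  obtain ⟨u, hu⟩ := LocalBihol.exists_logDeriv_eq hv hv0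
  refine ⟨u, v 0, hv0, ?_⟩
  filter_upwards [hα, hαv, hu] with w h1 h2 h3
  rw [← h3, ← h2]
  exact h1.2.2

/-- If the transverse one-form is `c du / u` on `τ`, then the holonomy group on `τ` is linear in
the coordinate `u`. -/
theorem IsAdditiveAtlas.isLinearizable_holonomyGroup (hA : F.IsAdditiveAtlas W A)
    (hsat : F.IsSaturated W) {p : M} {τ : F.Transversal p} (hτ : IsLogarithmic A τ) :
    DiffGerm.IsLinearizable (F.holonomyGroup τ) := by
  obtain ⟨u, c, hc, hu⟩ := hτ
  refine ⟨DiffGerm.mk u, ?_⟩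
  rintro g ⟨γ, -, -, -, hγ⟩
  obtain ⟨h, rfl, hinv⟩ := hA.invariant_of_isHolonomyOf hsat hγ
  obtain ⟨a, ha⟩ := u.comp_eq_const_mul_of_logDeriv h (by
    filter_upwards [hinv _ hu] with w hw
    rw [mul_assoc] at hw
    exact mul_left_cancel₀ hc hw)
  exact ⟨a, mul_inv_eq_of_eq_mul (DiffGerm.mk_eq_mk.2 ha)⟩

end

end TransvHolFoliation

theorem mainTheorem9 (ℓ : ℕ) {M : Type*} [TopologicalSpace M] [T2Space M]
    [ChartedSpace (EuclideanSpace ℝ (Fin (ℓ + 2))) M]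
    [IsManifold (𝓡 (ℓ + 2)) ∞ M]
    (F : TransvHolFoliation ℓ M)
    (Λ : Set M)
    (hΛ : ∃ S : Set (Set M), S.Finite ∧ (∀ L ∈ S, F.IsCompactLeaf L) ∧ Λ = ⋃₀ S)
    (hadd : F.IsTransvAdditiveOn Λᶜ)
    (L : Set M) (hL : F.IsLeaf L) (hLΛ : L ⊆ Λ)
    (hattr : F.HasHyperbolicAttractor L) :
    ∀ p ∈ L, ∀ τ : F.Transversal p,
      IsMulCommutative (F.holonomyGroup τ) ∧ DiffGerm.IsLinearizable (F.holonomyGroup τ) := by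
  obtain ⟨S, hSfin, hS, rfl⟩ := hΛ
  obtain ⟨A, hA1, hA2, hA3⟩ := hadd
  have hA : F.IsAdditiveAtlas (⋃₀ S)ᶜ A := ⟨fun a ha => (hA1 a ha).1, fun a ha => (hA1 a ha).2.1,
    fun a ha => (hA1 a ha).2.2, hA2, hA3⟩
  have hsat : F.IsSaturated (⋃₀ S)ᶜ := F.isSaturated_compl_sUnion fun L hL => (hS L hL).1
  obtain ⟨p₀, hp₀, τ₀, g, hg, hgattr⟩ := hattr
  have hW : ∀ᶠ w in 𝓝[≠] (0 : ℂ), τ₀.toFun w ∈ (⋃₀ S)ᶜ := by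
    filter_upwards [(hSfin.eventually_all).2 fun K hK =>
      τ₀.eventually_notMem_of_isCompactLeaf (hS K hK)] with w hw
    rintro ⟨K, hK, hwK⟩
    exact hw K hK hwK
  have hlog := hA.isLogarithmic_of_attractor hsat τ₀ hW hg hgattr
  intro p hp τ
  have hlin := hA.isLinearizable_holonomyGroup hsat
    (hA.isLogarithmic_of_leaf hsat hL hp₀ hp hlog τ)
  exact ⟨hlin.isMulCommutative, hlin⟩
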